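/- Let $p\in(1,\infty)$. There exists a function $\phi_p\colon(0,2]\times(0,1]\to(0,1]$, depending only on $p$, which is continuous and non-decreasing in each variable, such that the following holds for every $\sigma$-finite measure space $(X,\Sigma,\mathfrak m)$ and every $L^p(\mathfrak m)$-Banach $L^\infty(\mathfrak m)$-module $\mathscr M$. Here an $L^p(\mathfrak m)$-Banach $L^\infty(\mathfrak m)$-module is a module $\mathscr M$ over the ring $L^\infty(\mathfrak m)$ (real-valued functions) with a map $|\cdot|\colon\mathscr M\to L^p(\mathfrak m)$ such that, $\mathfrak m$-a.e., $|v|\ge 0$ for all $v$, with equality if and only if $v=0$, $|v+w|\le|v|+|w|$ for all $v,w$, and $|f\cdot v|=|f||v|$ for all $f\in L^\infty(\mathfrak m)$ and $v$, and which is complete for the norm $\|v\|_{\mathscr M}:=\||v|\|_{L^p(\mathfrak m)}$. For $\varepsilon\in(0,2]$ put \[ \delta_{\mathscr M}(\varepsilon):=\inf\Big\{1-\Big\|\frac{v+w}2\Big\|_{\mathscr M}\;\Big|\;v,w\in\mathscr M,\ \|v\|_{\mathscr M}=\|w\|_{\mathscr M}=1,\ \|v-w\|_{\mathscr M}\ge\varepsilon\Big\}\in[0,1]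 \] (with $\inf\varnothing:=1$, which occurs only for $\mathscr M=\{0\}$), and \[ \delta^{\rm pw}_{\mathscr M}(\varepsilon):=\bigwedge\Big\{1-\mathbf 1_E\Big|\frac{v+w}2\Big|\;\Big|\;v,w\in\mathscr M,\ E\in\Sigma,\ |v|=|w|=1\text{ and }|v-w|>\varepsilon\ \mathfrak m\text{-a.e. on }E\Big\}, \] where $\bigwedge$ is the greatest lower bound, for the $\mathfrak m$-a.e. order, among measurable functions $X\to[-\infty,+\infty]$ modulo $\mathfrak m$-a.e. equality. Moreover ${\rm ess\,inf}\,f:=\sup\{\lambda\in[-\infty,+\infty] : f\ge\lambda\ \mathfrak m\text{-a.e.}\}$. One says that $\mathscr M$ is uniformly convex as a Banach space if $\delta_{\mathscr M}(\varepsilon)>0$ for all $\varepsilon\in(0,2]$, and pointwise uniformly convex if ${\rm ess\,inf}\,\delta^{\rm pw}_{\mathscr M}(\varepsilon)>0$ for all $\varepsilon\in(0,2]$. Then $\mathscr M$ is pointwise uniformly convex if and only if it is uniformly convex as a Banach space. In this case, for every $\varepsilon\in(0,2]$, \[ \phi_p\big(\varepsilon,{\rm ess\,inf}\,\delta^{\rm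 pw}_{\mathscr M}(\varepsilon/5)\big)\le\delta_{\mathscr M}(\varepsilon)\le{\rm ess\,inf}\,\delta^{\rm pw}_{\mathscr M}(\varepsilon), \] where the first inequality is claimed when $\mathfrak m\neq0$ (if $\mathfrak m=0$ the essential infimum is $+\infty$). -/

import Mathlib

open MeasureTheory Set Filter
open scoped ENNReal

noncomputable section

namespace BanachModule

variable {X : Type*} [MeasurableSpace X] {μ : Measure X}

/-! ### The ring `L^∞(μ)` -/

/-- The commutative ring `L⁰(μ)` of real measurable functions up to a.e. equality, with the
pointwise operations (the addition and multiplication are those of Mathlib). -/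
instance instCommRingAEEqFun : CommRing (X →ₘ[μ] ℝ) where
  __ := (inferInstance : AddCommGroup (X →ₘ[μ] ℝ))
  __ := (inferInstance : CommMonoid (X →ₘ[μ] ℝ))
  left_distrib a b c := by
    apply AEEqFun.ext
    filter_upwards [AEEqFun.coeFn_mul a (b + c), AEEqFun.coeFn_add b c,
      AEEqFun.coeFn_add (a * b) (a * c), AEEqFun.coeFn_mul a b, AEEqFun.coeFn_mul a c]
      with x h1 h2 h3 h4 h5
    simp only [Pi.mul_apply, Pi.add_apply] at h1 h2 h3 h4 h5
    rw [h1, h2, h3, h4, h5, mul_add]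
  right_distrib a b c := by
    apply AEEqFun.ext
    filter_upwards [AEEqFun.coeFn_mul (a + b) c, AEEqFun.coeFn_add a b,
      AEEqFun.coeFn_add (a * c) (b * c), AEEqFun.coeFn_mul a c, AEEqFun.coeFn_mul b c]
      with x h1 h2 h3 h4 h5
    simp only [Pi.mul_apply, Pi.add_apply] at h1 h2 h3 h4 h5
    rw [h1, h2, h3, h4, h5, add_mul]
  zero_mul a := by
    apply AEEqFun.ext
    filter_upwards [AEEqFun.coeFn_mul 0 a, AEEqFun.coeFn_zero (μ := μ) (β := ℝ)] with x h1 h2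
    simp only [Pi.mul_apply] at h1
    rw [h1, h2]; simp
  mul_zero a := by
    apply AEEqFun.ext
    filter_upwards [AEEqFun.coeFn_mul a 0, AEEqFun.coeFn_zero (μ := μ) (β := ℝ)] with x h1 h2
    simp only [Pi.mul_apply] at h1
    rw [h1, h2]; simp

instance instAlgebraAEEqFun : Algebra ℝ (X →ₘ[μ] ℝ) :=
  Algebra.ofModule
    (fun r a b => by
      apply AEEqFun.ext
      filter_upwards [AEEqFun.coeFn_mul (r • a) b, AEEqFun.coeFn_smul r a,
        AEEqFun.coeFn_smul r (a * b), AEEqFun.coeFn_mul a b] with x h1 h2 h3 h4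
      simp only [Pi.mul_apply, Pi.smul_apply, smul_eq_mul] at h1 h2 h3 h4
      rw [h1, h2, h3, h4, mul_assoc])
    (fun r a b => by
      apply AEEqFun.ext
      filter_upwards [AEEqFun.coeFn_mul a (r • b), AEEqFun.coeFn_smul r b,
        AEEqFun.coeFn_smul r (a * b), AEEqFun.coeFn_mul a b] with x h1 h2 h3 h4
      simp only [Pi.mul_apply, Pi.smul_apply, smul_eq_mul] at h1 h2 h3 h4
      rw [h1, h2, h3, h4]; ring)

/-- `L^∞(μ)`: the essentially bounded elements of `L⁰(μ)`, a commutative `ℝ`-algebra under the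
pointwise operations. -/
def LInfty (μ : Measure X) : Subalgebra ℝ (X →ₘ[μ] ℝ) where
  carrier := {f | ∃ C : ℝ, ∀ᵐ x ∂μ, |f x| ≤ C}
  mul_mem' := by
    rintro a b ⟨C, hC⟩ ⟨D, hD⟩
    refine ⟨C * D, ?_⟩
    filter_upwards [hC, hD, AEEqFun.coeFn_mul a b] with x h1 h2 h3
    rw [h3, Pi.mul_apply, abs_mul]
    exact mul_le_mul h1 h2 (abs_nonneg _) ((abs_nonneg _).trans h1)
  add_mem' := by
    rintro a b ⟨C, hC⟩ ⟨D, hD⟩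
    refine ⟨C + D, ?_⟩
    filter_upwards [hC, hD, AEEqFun.coeFn_add a b] with x h1 h2 h3
    rw [h3, Pi.add_apply]
    exact (abs_add_le _ _).trans (add_le_add h1 h2)
  algebraMap_mem' r := by
    refine ⟨|r|, ?_⟩
    rw [Algebra.algebraMap_eq_smul_one]
    filter_upwards [AEEqFun.coeFn_smul r (1 : X →ₘ[μ] ℝ),
      AEEqFun.coeFn_one (μ := μ) (β := ℝ)] with x h1 h2
    rw [h1, Pi.smul_apply, h2]; simp

/-! ### Normed modules -/

/-- The structure of an `L^p(μ)`-normed `L^∞(μ)`-module on the `L^∞(μ)`-module `M`: a pointwise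
norm `|·| : M → L^p(μ)`, compatible with the norm of `M` in the sense that `‖v‖` is the `L^p` norm
of `|v|`. The multiplication by a real number is that by the constant function (this is
`IsScalarTower`). It is an `L^p(μ)`-Banach `L^∞(μ)`-module when moreover `CompleteSpace M`. -/
class LpNormedModule (p : ℝ≥0∞) (μ : Measure X) (M : Type*) [NormedAddCommGroup M]
    [NormedSpace ℝ M] [Module (LInfty μ) M] [IsScalarTower ℝ (LInfty μ) M] where
  /-- the pointwise norm `v ↦ |v|` -/
  ptNorm : M → Lp ℝ p μ
  ptNorm_nonneg : ∀ v, ∀ᵐ x ∂μ, 0 ≤ ptNorm v x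
  ptNorm_eq_zero_iff : ∀ v, ptNorm v = 0 ↔ v = 0
  ptNorm_add_le : ∀ v w, ∀ᵐ x ∂μ, ptNorm (v + w) x ≤ ptNorm v x + ptNorm w x
  ptNorm_smul : ∀ (f : LInfty μ) (v : M),
    ∀ᵐ x ∂μ, ptNorm (f • v) x = |(f : X →ₘ[μ] ℝ) x| * ptNorm v x
  norm_eq : ∀ v, ‖v‖ = ‖ptNorm v‖

/-! ### Uniform convexity of Banach spaces -/

/-- The modulus of convexity `δ_B(ε)`, the infimum in `[0, 1]` of `1 - ‖(v + w) / 2‖` over unit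
vectors `v, w` with `‖v - w‖ ≥ ε`. Inserting `1`, the top element of `[0, 1]`, only says that the
infimum of the empty family (which occurs for `ε ≤ 2` only if `B = 0`) is `1`. -/
def modulus (B : Type*) [NormedAddCommGroup B] [NormedSpace ℝ B] (ε : ℝ) : ℝ :=
  sInf (insert 1 {r | ∃ v w : B, ‖v‖ = 1 ∧ ‖w‖ = 1 ∧ ε ≤ ‖v - w‖ ∧
    r = 1 - ‖(1 / 2 : ℝ) • (v + w)‖})

/-- Uniform convexity of a Banach space. -/
def IsUniformlyConvex (B : Type*) [NormedAddCommGroup B] [NormedSpace ℝ B] : Prop :=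
  ∀ ε ∈ Ioc (0 : ℝ) 2, 0 < modulus B ε

/-! ### The infimum of a family in `L⁰_ext(μ)` -/

/-- Over a `σ`-finite measure, every family of extended real measurable functions has a greatest
lower bound for the a.e. order. -/
theorem exists_isGLB [SigmaFinite μ] (S : Set (X →ₘ[μ] EReal)) : ∃ f, IsGLB S f := by
  rcases S.eq_empty_or_nonempty with rfl | ⟨s₀, hs₀⟩
  · refine ⟨AEEqFun.const X ⊤, by simp, fun g _ => ?_⟩
    rw [← AEEqFun.coeFn_le]
    filter_upwards [AEEqFun.coeFn_const X (μ := μ) (⊤ : EReal)] with x hx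
    rw [hx]; exact le_top
  -- a bounded strictly increasing function `h` and an equivalent finite measure `ν`
  let e : EReal ≃o Icc (0 : ℝ) 1 :=
    EReal.expOrderIso.trans ENNReal.orderIsoUnitIntervalBirational
  let h : EReal → ℝ≥0∞ := fun y => ENNReal.ofReal (e y)
  have h_meas : Measurable h :=
    (measurable_subtype_coe.comp e.continuous.measurable).ennreal_ofReal
  have h_mono : Monotone h := fun a b hab => ENNReal.ofReal_le_ofReal (e.monotone hab)
  have h_inj : ∀ a b, h a = h b → a = b := fun a b hab => by
    have := (ENNReal.ofReal_eq_ofReal_iff (e a).2.1 (e b).2.1).1 hab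
    exact e.injective (Subtype.ext this)
  have h_one : ∀ a, h a ≤ 1 := fun a => ENNReal.ofReal_le_one.2 (e a).2.2
  let ν := μ.toFinite
  have hν : ae ν = ae μ := ae_toFinite
  -- minimise over the countable subfamilies
  let F : (ℕ → S) → X → EReal := fun u x => ⨅ n, ((u n : X →ₘ[μ] EReal) : X → EReal) x
  have F_meas : ∀ u, Measurable (F u) := fun u => .iInf fun n => (u n).1.measurable
  let J : (ℕ → S) → ℝ≥0∞ := fun u => ∫⁻ x, h (F u x) ∂ν
  have J_fin : ∀ u, J u ≠ ∞ := fun u => by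
    have : J u ≤ ∫⁻ _, 1 ∂ν := lintegral_mono fun x => h_one _
    refine ne_top_of_le_ne_top ?_ this
    simp
  have : Nonempty (ℕ → S) := ⟨fun _ => ⟨s₀, hs₀⟩⟩
  obtain ⟨a, -, -, ha_lim, ha_mem⟩ := (isGLB_sInf (range J)).exists_seq_antitone_tendsto
    (range_nonempty J)
  choose u hu using ha_mem
  let w : ℕ → S := fun n => u n.unpair.1 n.unpair.2
  have hwu : ∀ k x, F w x ≤ F (u k) x := fun k x => le_iInf fun n => by
    have := iInf_le (fun m => ((w m : X →ₘ[μ] EReal) : X → EReal) x) (Nat.pair k n)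
    simpa [w] using this
  have hw : ∀ t, J w ≤ J t := fun t => by
    have h1 : J w ≤ sInf (range J) := ge_of_tendsto' ha_lim fun k => by
      rw [← hu k]; exact lintegral_mono fun x => h_mono (hwu k x)
    exact h1.trans (sInf_le ⟨t, rfl⟩)
  refine ⟨AEEqFun.mk (F w) (F_meas w).aestronglyMeasurable, ?_, ?_⟩
  · intro f hf
    let t : ℕ → S := fun n => Nat.casesOn n ⟨f, hf⟩ w
    have htw : ∀ x, F t x ≤ F w x := fun x => le_iInf fun n => by
      have := iInf_le (fun m => ((t m : X →ₘ[μ] EReal) : X → EReal) x) (n + 1)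
      exact this
    have htf : ∀ x, F t x ≤ f x := fun x => by
      have := iInf_le (fun m => ((t m : X →ₘ[μ] EReal) : X → EReal) x) 0
      exact this
    have key := ae_eq_of_ae_le_of_lintegral_le (μ := ν)
      (.of_forall fun x => h_mono (htw x)) (J_fin t)
      (h_meas.comp (F_meas w)).aemeasurable (hw t)
    rw [Filter.EventuallyEq, hν] at key
    rw [← AEEqFun.coeFn_le]
    filter_upwards [key, AEEqFun.coeFn_mk (F w) (F_meas w).aestronglyMeasurable (μ := μ)]
      with x hx hx'
    rw [hx', ← h_inj _ _ hx]
    exact htf x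
  · intro g hg
    rw [← AEEqFun.coeFn_le]
    have : ∀ᵐ x ∂μ, ∀ n, g x ≤ ((w n : X →ₘ[μ] EReal) : X → EReal) x :=
      ae_all_iff.2 fun n => AEEqFun.coeFn_le.2 (hg (w n).2)
    filter_upwards [this, AEEqFun.coeFn_mk (F w) (F_meas w).aestronglyMeasurable (μ := μ)]
      with x hx hx'
    rw [hx']
    exact le_iInf hx

/-- The infimum `⋀ S ∈ L⁰_ext(μ)` of a (possibly uncountable) family `S` in `L⁰_ext(μ)`, that is,
its greatest lower bound for the a.e. order. -/
def familyInf [SigmaFinite μ] (S : Set (X →ₘ[μ] EReal)) : X →ₘ[μ] EReal :=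
  (exists_isGLB S).choose

theorem isGLB_familyInf [SigmaFinite μ] (S : Set (X →ₘ[μ] EReal)) : IsGLB S (familyInf S) :=
  (exists_isGLB S).choose_spec

/-! ### Pointwise uniform convexity -/

section Pointwise

variable (μ) (p : ℝ≥0∞) [SigmaFinite μ] (M : Type*) [NormedAddCommGroup M] [NormedSpace ℝ M]
  [Module (LInfty μ) M] [IsScalarTower ℝ (LInfty μ) M] [LpNormedModule p μ M]

open LpNormedModule in
/-- The pointwise modulus of convexity `δ^pw_M(ε)`: the infimum in `L⁰_ext(μ)` of the functions
`1 - 1_E |(v + w) / 2|` over all `v, w ∈ M` and all measurable sets `E` such that `|v| = |w| = 1`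
and `|v - w| > ε` a.e. on `E`. -/
def ptModulus (ε : ℝ) : X →ₘ[μ] EReal :=
  familyInf {g | ∃ (v w : M) (E : Set X), MeasurableSet E ∧
    (∀ᵐ x ∂μ, x ∈ E → ptNorm (p := p) (μ := μ) v x = 1 ∧ ptNorm (p := p) (μ := μ) w x = 1 ∧
      ε < ptNorm (p := p) (μ := μ) (v - w) x) ∧
    ∀ᵐ x ∂μ, g x =
      ((1 - E.indicator (fun y => ptNorm (p := p) (μ := μ) ((1 / 2 : ℝ) • (v + w)) y) x : ℝ) :
        EReal)}

/-- The essential infimum (in `ℝ ∪ {±∞}`) of the pointwise modulus of convexity. -/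
def essInfPtModulus (ε : ℝ) : EReal :=
  essInf (fun x => ptModulus μ p M ε x) μ

/-- Pointwise uniform convexity. -/
def IsPtUniformlyConvex : Prop :=
  ∀ ε ∈ Ioc (0 : ℝ) 2, 0 < essInfPtModulus μ p M ε

end Pointwise

end BanachModule

end

universe u v

open BanachModule

/-! Write `P` for the exponent. The bound of the Banach-space modulus by the pointwise one is a
localisation argument. If `|v| = |w| = 1`, `|v - w| > ε` and `|(v + w) / 2| ≥ 1 - δ` held on a set
of positive measure, then multiplying `v` and `w` by a normalised indicator of a subset of finite
positive measure would give unit vectors of `M`, at distance at least `ε`, with midpoint of norm at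
least `1 - δ`; this is impossible for `δ < modulus M ε` (`measure_eq_zero_of_lt_modulus`).

For the other bound, unit vectors of `M` need not have pointwise norm one, so pointwise convexity
must first be extended to vectors with different pointwise norms (`pt_add_le_of_pt_sub_gt`). This
feeds a scalar inequality (`rpow_dist_le`): with `a = |v|`, `b = |w|`, `d = |v - w|`, `s = |v + w|`,
the power `d ^ P` is at most a small multiple of `a ^ P + b ^ P` plus a constant times the midpoint
defect `(a ^ P + b ^ P) / 2 - (s / 2) ^ P`. The defect is large either because `a` and `b` differ,
by strict convexity of `x ↦ x ^ P`, or because they are close and pointwise convexity makes `s`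
small. Integrating absorbs the small term and bounds `1 - ‖(v + w) / 2‖ ^ P` from below. -/

noncomputable section

namespace BanachModule

/-! ### Scalar inequalities for `P`-th powers -/

section Scalar

/-- The defect of midpoint convexity of `x ↦ x ^ P` between `1` and `1 - θ`. -/
def rpowGap (P θ : ℝ) : ℝ := (1 + (1 - θ) ^ P) / 2 - (1 - θ / 2) ^ P

theorem continuous_rpowGap {P : ℝ} (hP : 1 < P) : Continuous (rpowGap P) := by
  have h0 : 0 ≤ P := by linarith
  have h1 : Continuous fun θ : ℝ => (1 - θ) ^ P :=
    (continuous_const.sub continuous_id).rpow_const fun _ => Or.inr h0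
  have h2 : Continuous fun θ : ℝ => (1 - θ / 2) ^ P :=
    (continuous_const.sub (continuous_id.div_const 2)).rpow_const fun _ => Or.inr h0
  exact ((continuous_const.add h1).div_const 2).sub h2

theorem rpowGap_monotoneOn {P : ℝ} (hP : 1 < P) : MonotoneOn (rpowGap P) (Icc 0 1) := by
  have hd : ∀ θ : ℝ, HasDerivAt (rpowGap P)
      ((-1 * P * (1 - θ) ^ (P - 1)) / 2 - (-(1 / 2)) * P * (1 - θ / 2) ^ (P - 1)) θ := by
    intro θ
    have h1 : HasDerivAt (fun θ : ℝ => 1 - θ) (-1) θ := by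
      simpa using (hasDerivAt_id θ).const_sub 1
    have h2 : HasDerivAt (fun θ : ℝ => 1 - θ / 2) (-(1 / 2)) θ := by
      simpa using ((hasDerivAt_id θ).div_const 2).const_sub 1
    exact (((h1.rpow_const (p := P) (Or.inr hP.le)).const_add 1).div_const 2).sub
      (h2.rpow_const (p := P) (Or.inr hP.le))
  refine monotoneOn_of_deriv_nonneg (convex_Icc 0 1) (continuous_rpowGap hP).continuousOn
    (fun θ _ => (hd θ).differentiableAt.differentiableWithinAt) fun θ hθ => ?_
  rw [interior_Icc] at hθ
  rw [(hd θ).deriv]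
  have : (1 - θ) ^ (P - 1) ≤ (1 - θ / 2) ^ (P - 1) :=
    Real.rpow_le_rpow (by linarith [hθ.2]) (by linarith [hθ.1]) (by linarith)
  nlinarith

theorem rpowGap_pos {P θ : ℝ} (hP : 1 < P) (h0 : 0 < θ) (h1 : θ ≤ 1) : 0 < rpowGap P θ := by
  have := (strictConvexOn_rpow hP).2 (show (1 : ℝ) ∈ Ici 0 by simp)
    (show 1 - θ ∈ Ici 0 by simpa using h1) (by linarith) (show (0 : ℝ) < 1 / 2 by norm_num)
    (show (0 : ℝ) < 1 / 2 by norm_num) (by norm_num)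
  simp only [smul_eq_mul, Real.one_rpow] at this
  rw [show (1 / 2 * 1 + 1 / 2 * (1 - θ) : ℝ) = 1 - θ / 2 by ring] at this
  unfold rpowGap
  linarith

theorem midpoint_rpow_le {P a b : ℝ} (hP : 1 < P) (ha : 0 ≤ a) (hb : 0 ≤ b) :
    ((a + b) / 2) ^ P ≤ (a ^ P + b ^ P) / 2 := by
  have := (convexOn_rpow hP.le).2 (show a ∈ Ici 0 from ha) (show b ∈ Ici 0 from hb)
    (show (0 : ℝ) ≤ 1 / 2 by norm_num) (show (0 : ℝ) ≤ 1 / 2 by norm_num) (by norm_num)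
  simp only [smul_eq_mul] at this
  rw [show (1 / 2 * a + 1 / 2 * b : ℝ) = (a + b) / 2 by ring] at this
  linarith

/-- Both sides are homogeneous of degree `P`, so dividing by `a` reduces to the pair `1`, `b / a`,
where the right side is the gap at `1 - b / a ≥ θ`. -/
theorem rpowGap_mul_le {P a b θ : ℝ} (hP : 1 < P) (ha : 0 < a) (hb : 0 ≤ b) (hθ : 0 ≤ θ)
    (hab : θ * a ≤ a - b) :
    rpowGap P θ * a ^ P ≤ (a ^ P + b ^ P) / 2 - ((a + b) / 2) ^ P := by
  have hr1 : 1 - b / a ≤ 1 := by linarith [div_nonneg hb ha.le]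
  have hr0 : θ ≤ 1 - b / a := by
    rw [le_sub_comm, div_le_iff₀ ha]; linarith
  have h := rpowGap_monotoneOn hP ⟨hθ, hr0.trans hr1⟩ ⟨hθ.trans hr0, hr1⟩ hr0
  have e1 : (b / a) ^ P * a ^ P = b ^ P := by
    rw [← Real.mul_rpow (div_nonneg hb ha.le) ha.le, div_mul_cancel₀ _ ha.ne']
  have e2 : (1 - (1 - b / a) / 2) ^ P * a ^ P = ((a + b) / 2) ^ P := by
    rw [← Real.mul_rpow (by linarith) ha.le]
    congr 1; field_simp; ring
  calc rpowGap P θ * a ^ P ≤ rpowGap P (1 - b / a) * a ^ P :=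
        mul_le_mul_of_nonneg_right h (Real.rpow_nonneg ha.le _)
    _ = _ := by
        unfold rpowGap
        rw [sub_mul, e2, sub_sub_cancel, ← e1]; ring

/-- The constant in the lower bound for the modulus of convexity. -/
def gapConst (P ε t : ℝ) : ℝ := min ((9 / 10) ^ P * t) (rpowGap P (ε / 20))

theorem gapConst_pos {P ε t : ℝ} (hP : 1 < P) (hε : ε ∈ Ioc (0 : ℝ) 2) (ht : 0 < t) :
    0 < gapConst P ε t :=
  lt_min (by positivity) (rpowGap_pos hP (by linarith [hε.1]) (by linarith [hε.2]))

/-- The two entries of the minimum in `gapConst` match two cases: `a` and `b` relatively far apart,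
where strict convexity of the power suffices, and `a` and `b` close, where `H` applies. -/
theorem gapConst_mul_rpow_le {P ε t a b d s : ℝ} (hP : 1 < P) (hε : ε ∈ Ioc (0 : ℝ) 2)
    (ht : t ∈ Ioc (0 : ℝ) 1) (ha : 0 < a) (hb : 0 ≤ b) (hba : b ≤ a) (hs : 0 ≤ s)
    (hsab : s ≤ a + b) (hd : ε / 4 * a < d)
    (H : |a - b| + ε / 5 * min a b < d → s ≤ a + b - 2 * t * min a b) :
    gapConst P ε t * a ^ P ≤ (a ^ P + b ^ P) / 2 - (s / 2) ^ P := by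
  obtain ⟨hε0, hε2⟩ := hε
  obtain ⟨ht0, ht1⟩ := ht
  have hP0 : 0 ≤ P := by linarith
  have haP : 0 ≤ a ^ P := Real.rpow_nonneg ha.le _
  rcases le_or_gt (ε / 20 * a) (a - b) with h | h
  · have h1 : gapConst P ε t * a ^ P ≤ rpowGap P (ε / 20) * a ^ P :=
      mul_le_mul_of_nonneg_right (min_le_right _ _) haP
    have h2 := rpowGap_mul_le hP ha hb (by positivity) h
    have h3 : (s / 2) ^ P ≤ ((a + b) / 2) ^ P :=
      Real.rpow_le_rpow (by linarith) (by linarith) hP0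
    linarith
  · rw [min_eq_right hba, abs_of_nonneg (by linarith)] at H
    -- The constants are chosen so that `ε / 20 + ε / 5 = ε / 4`, which verifies the premise of `H`.
    -- Since `ε ≤ 2`, closeness also gives `b ≥ (1 - ε / 20) * a ≥ 9 / 10 * a`.
    have hbε : ε / 5 * b ≤ ε / 5 * a := mul_le_mul_of_nonneg_left hba (by positivity)
    have hs' := H (by linarith)
    have hb9 : 9 / 10 * a ≤ b := by nlinarith
    have hb0 : 0 < b := by linarith
    set m := (a + b) / 2 with hm
    have hbm : b ≤ m := by linarith
    have hm0 : 0 < m := by linarith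
    have hy0 : 0 ≤ b * t / m := by positivity
    have hy1 : b * t / m ≤ 1 := by
      rw [div_le_one hm0]; nlinarith
    -- `H` says `s / 2 ≤ m - b * t`; a number in `[0, 1]` only decreases when raised to the power `P
    -- ≥ 1`.
    have h1 : (s / 2) ^ P ≤ m ^ P * (1 - b * t / m) := by
      calc (s / 2) ^ P ≤ (m * (1 - b * t / m)) ^ P := by
            refine Real.rpow_le_rpow (by linarith) ?_ hP0
            rw [mul_sub, mul_div_cancel₀ _ hm0.ne']; linarith
        _ = m ^ P * (1 - b * t / m) ^ P := Real.mul_rpow hm0.le (by linarith)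
        _ ≤ m ^ P * (1 - b * t / m) := by
            refine mul_le_mul_of_nonneg_left ?_ (Real.rpow_nonneg hm0.le _)
            rcases (sub_nonneg.2 hy1).eq_or_lt with h0 | h0
            · rw [← h0, Real.zero_rpow (by linarith)]
            · calc (1 - b * t / m) ^ P ≤ (1 - b * t / m) ^ (1 : ℝ) :=
                    Real.rpow_le_rpow_of_exponent_ge h0 (by linarith) hP.le
                _ = _ := Real.rpow_one _
    have h2 : (9 / 10) ^ P * t * a ^ P ≤ m ^ P * (b * t / m) := by
      have e1 : m ^ P * (b * t / m) = m ^ (P - 1) * (b * t) := by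
        rw [Real.rpow_sub_one hm0.ne']; ring
      have e2 : b ^ P = b ^ (P - 1) * b := by
        rw [Real.rpow_sub_one hb0.ne']; field_simp
      have e3 : b ^ (P - 1) ≤ m ^ (P - 1) := Real.rpow_le_rpow hb hbm (by linarith)
      have e4 : (9 / 10 * a) ^ P ≤ b ^ P := Real.rpow_le_rpow (by positivity) hb9 hP0
      rw [Real.mul_rpow (by norm_num) ha.le] at e4
      rw [e1]
      calc (9 / 10) ^ P * t * a ^ P = ((9 / 10) ^ P * a ^ P) * t := by ring
        _ ≤ (b ^ (P - 1) * b) * t := by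
            rw [← e2]; exact mul_le_mul_of_nonneg_right e4 ht0.le
        _ = b ^ (P - 1) * (b * t) := by ring
        _ ≤ _ := mul_le_mul_of_nonneg_right e3 (by positivity)
    have h3 : gapConst P ε t * a ^ P ≤ (9 / 10) ^ P * t * a ^ P :=
      mul_le_mul_of_nonneg_right (min_le_left _ _) haP
    have h4 : m ^ P ≤ (a ^ P + b ^ P) / 2 := midpoint_rpow_le hP ha.le hb
    rw [mul_sub, mul_one] at h1
    linarith

/-- For `b ≤ a`, a distance `d ≤ ε / 4 * a` is paid for by the first term. Otherwise `d ≤ 2 * a`,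
and the defect controls `a ^ P`. -/
theorem rpow_dist_le {P ε t a b d s : ℝ} (hP : 1 < P) (hε : ε ∈ Ioc (0 : ℝ) 2)
    (ht : t ∈ Ioc (0 : ℝ) 1) (ha : 0 ≤ a) (hb : 0 ≤ b) (hd0 : 0 ≤ d) (hdab : d ≤ a + b)
    (hs : 0 ≤ s) (hsab : s ≤ a + b)
    (H : |a - b| + ε / 5 * min a b < d → s ≤ a + b - 2 * t * min a b) :
    d ^ P ≤ (ε / 4) ^ P * (a ^ P + b ^ P) +
      2 ^ P / gapConst P ε t * ((a ^ P + b ^ P) / 2 - (s / 2) ^ P) := by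
  wlog hba : b ≤ a generalizing a b
  · have := this hb ha (by linarith) (by linarith)
      (by rw [abs_sub_comm, min_comm, add_comm b a]; exact H) (le_of_not_ge hba)
    rwa [add_comm (b ^ P)] at this
  have hP0 : 0 ≤ P := by linarith
  have hε0 := hε.1
  have hc := gapConst_pos hP hε ht.1
  have haP : 0 ≤ a ^ P := Real.rpow_nonneg ha _
  have hbP : 0 ≤ b ^ P := Real.rpow_nonneg hb _
  have hgap : 0 ≤ (a ^ P + b ^ P) / 2 - (s / 2) ^ P := by
    have h3 : (s / 2) ^ P ≤ ((a + b) / 2) ^ P :=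
      Real.rpow_le_rpow (by linarith) (by linarith) hP0
    linarith [midpoint_rpow_le hP ha hb]
  rcases le_or_gt d (ε / 4 * a) with h | h
  · have h1 : d ^ P ≤ (ε / 4) ^ P * a ^ P := by
      rw [← Real.mul_rpow (by positivity) ha]
      exact Real.rpow_le_rpow hd0 h hP0
    have h2 : 0 ≤ (ε / 4) ^ P * b ^ P := by positivity
    have h3 : 0 ≤ 2 ^ P / gapConst P ε t * ((a ^ P + b ^ P) / 2 - (s / 2) ^ P) := by positivity
    linarith
  · have ha0 : 0 < a := by
      rcases ha.eq_or_lt with h0 | h0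
      · subst h0; linarith
      · exact h0
    have h1 := gapConst_mul_rpow_le hP hε ht ha0 hb hba hs hsab h H
    have h2 : d ^ P ≤ 2 ^ P * a ^ P := by
      rw [← Real.mul_rpow (by norm_num) ha]
      exact Real.rpow_le_rpow hd0 (by linarith) hP0
    have h3 : 2 ^ P * a ^ P ≤
        2 ^ P / gapConst P ε t * ((a ^ P + b ^ P) / 2 - (s / 2) ^ P) := by
      rw [div_mul_eq_mul_div, le_div_iff₀ hc, mul_assoc, mul_comm (a ^ P)]
      exact mul_le_mul_of_nonneg_left h1 (by positivity)
    have h4 : 0 ≤ (ε / 4) ^ P * (a ^ P + b ^ P) := by positivity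
    linarith

/-- The lower bound for the modulus of convexity. -/
def convexityBound (P ε t : ℝ) : ℝ := ε ^ P * gapConst P ε t / (2 * 2 ^ P * P)

theorem convexityBound_pos {P ε t : ℝ} (hP : 1 < P) (hε : ε ∈ Ioc (0 : ℝ) 2) (ht : 0 < t) :
    0 < convexityBound P ε t := by
  have := gapConst_pos hP hε ht
  have := hε.1
  unfold convexityBound
  positivity

theorem convexityBound_le_one {P ε t : ℝ} (hP : 1 < P) (hε : ε ∈ Ioc (0 : ℝ) 2)
    (ht : t ∈ Ioc (0 : ℝ) 1) : convexityBound P ε t ≤ 1 := by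
  have hc := gapConst_pos hP hε ht.1
  have h1 : gapConst P ε t ≤ 1 := by
    refine (min_le_left _ _).trans (mul_le_one₀ ?_ ht.1.le ht.2)
    exact Real.rpow_le_one (by norm_num) (by norm_num) (by linarith)
  have h2 : ε ^ P ≤ 2 ^ P := Real.rpow_le_rpow hε.1.le hε.2 (by linarith)
  have h3 : (0 : ℝ) < 2 ^ P := by positivity
  unfold convexityBound
  rw [div_le_one (by positivity)]
  calc ε ^ P * gapConst P ε t ≤ 2 ^ P * 1 := mul_le_mul h2 h1 hc.le h3.le
    _ ≤ 2 * 2 ^ P * P := by nlinarith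

theorem continuousOn_convexityBound {P : ℝ} (hP : 1 < P) (S : Set (ℝ × ℝ)) :
    ContinuousOn (fun z : ℝ × ℝ => convexityBound P z.1 z.2) S := by
  have h1 : Continuous fun z : ℝ × ℝ => z.1 ^ P :=
    continuous_fst.rpow_const fun _ => Or.inr (by linarith)
  have h2 : Continuous fun z : ℝ × ℝ => gapConst P z.1 z.2 :=
    (continuous_const.mul continuous_snd).min
      ((continuous_rpowGap hP).comp (continuous_fst.div_const 20))
  exact ((h1.mul h2).div_const _).continuousOn

theorem convexityBound_mono_left {P t : ℝ} (hP : 1 < P) (ht : t ∈ Ioc (0 : ℝ) 1) :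
    MonotoneOn (fun ε => convexityBound P ε t) (Ioc (0 : ℝ) 2) := by
  intro ε hε ε' hε' h
  have hP0 : 0 ≤ P := by linarith
  have hg : gapConst P ε t ≤ gapConst P ε' t :=
    min_le_min_left _ (rpowGap_monotoneOn hP ⟨by linarith [hε.1], by linarith [hε.2]⟩
      ⟨by linarith [hε'.1], by linarith [hε'.2]⟩ (by linarith))
  exact div_le_div_of_nonneg_right (mul_le_mul (Real.rpow_le_rpow hε.1.le h hP0) hg
    (gapConst_pos hP hε ht.1).le (Real.rpow_nonneg hε'.1.le _)) (by positivity)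

theorem convexityBound_mono_right {P ε : ℝ} (hP : 1 < P) (hε : ε ∈ Ioc (0 : ℝ) 2) :
    MonotoneOn (fun t => convexityBound P ε t) (Ioc (0 : ℝ) 1) := by
  intro t _ t' _ h
  have hP0 : 0 ≤ P := by linarith
  have hg : gapConst P ε t ≤ gapConst P ε t' :=
    min_le_min_right _ (mul_le_mul_of_nonneg_left h (by positivity))
  exact div_le_div_of_nonneg_right
    (mul_le_mul_of_nonneg_left hg (Real.rpow_nonneg hε.1.le _)) (by positivity)

end Scalar

/-! ### Bounded functions as elements of `L^∞(μ)` -/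

section Calculus

variable {X : Type*} [MeasurableSpace X] {μ : Measure X}

/-- The element of `L^∞(μ)` given by a bounded measurable function. -/
def LInfty.ofBounded (μ : Measure X) (u : X → ℝ) (hu : Measurable u) (h : ∃ C, ∀ x, |u x| ≤ C) :
    LInfty μ :=
  ⟨AEEqFun.mk u hu.aestronglyMeasurable, by
    obtain ⟨C, hC⟩ := h
    refine ⟨C, ?_⟩
    filter_upwards [AEEqFun.coeFn_mk u hu.aestronglyMeasurable (μ := μ)] with x hx
    rw [hx]; exact hC x⟩

theorem LInfty.coeFn_ofBounded {u : X → ℝ} (hu : Measurable u) (h : ∃ C, ∀ x, |u x| ≤ C) :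
    ∀ᵐ x ∂μ, (LInfty.ofBounded μ u hu h : X →ₘ[μ] ℝ) x = u x :=
  AEEqFun.coeFn_mk u hu.aestronglyMeasurable

theorem LInfty.ext_ae {f g : LInfty μ}
    (h : ∀ᵐ x ∂μ, (f : X →ₘ[μ] ℝ) x = (g : X →ₘ[μ] ℝ) x) : f = g :=
  Subtype.ext (AEEqFun.ext h)

theorem LInfty.coeFn_mul (f g : LInfty μ) :
    ∀ᵐ x ∂μ, ((f * g : LInfty μ) : X →ₘ[μ] ℝ) x = (f : X →ₘ[μ] ℝ) x * (g : X →ₘ[μ] ℝ) x :=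
  AEEqFun.coeFn_mul (f : X →ₘ[μ] ℝ) g

theorem LInfty.coeFn_add (f g : LInfty μ) :
    ∀ᵐ x ∂μ, ((f + g : LInfty μ) : X →ₘ[μ] ℝ) x = (f : X →ₘ[μ] ℝ) x + (g : X →ₘ[μ] ℝ) x :=
  AEEqFun.coeFn_add (f : X →ₘ[μ] ℝ) g

theorem LInfty.coeFn_smul_one (r : ℝ) :
    ∀ᵐ x ∂μ, ((r • (1 : LInfty μ) : LInfty μ) : X →ₘ[μ] ℝ) x = r := by
  filter_upwards [AEEqFun.coeFn_smul r (1 : X →ₘ[μ] ℝ),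
    AEEqFun.coeFn_one (μ := μ) (β := ℝ)] with x h1 h2
  change (r • (1 : X →ₘ[μ] ℝ) : X →ₘ[μ] ℝ) x = r
  rw [h1, Pi.smul_apply, h2]; simp

end Calculus

/-! ### Pointwise norms and their integrals -/

section Pointwise

variable {X : Type*} [MeasurableSpace X] (p : ℝ≥0∞) (μ : Measure X)
  {M : Type*} [NormedAddCommGroup M] [NormedSpace ℝ M]
  [Module (LInfty μ) M] [IsScalarTower ℝ (LInfty μ) M] [LpNormedModule p μ M]

/-- The pointwise norm as a function. -/
def pt (v : M) : X → ℝ := fun x => LpNormedModule.ptNorm (p := p) (μ := μ) v x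

theorem measurable_pt (v : M) : Measurable (pt p μ v) :=
  (Lp.stronglyMeasurable (LpNormedModule.ptNorm (p := p) (μ := μ) v)).measurable

theorem pt_nonneg (v : M) : ∀ᵐ x ∂μ, 0 ≤ pt p μ v x := LpNormedModule.ptNorm_nonneg v

theorem pt_add_le (v w : M) : ∀ᵐ x ∂μ, pt p μ (v + w) x ≤ pt p μ v x + pt p μ w x :=
  LpNormedModule.ptNorm_add_le v w

theorem pt_smul (f : LInfty μ) (v : M) :
    ∀ᵐ x ∂μ, pt p μ (f • v) x = |(f : X →ₘ[μ] ℝ) x| * pt p μ v x :=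
  LpNormedModule.ptNorm_smul f v

theorem pt_ofBounded_smul {u : X → ℝ} (hu : Measurable u) (h : ∃ C, ∀ x, |u x| ≤ C) (v : M) :
    ∀ᵐ x ∂μ, pt p μ (LInfty.ofBounded μ u hu h • v) x = |u x| * pt p μ v x := by
  filter_upwards [pt_smul p μ (LInfty.ofBounded μ u hu h) v,
    LInfty.coeFn_ofBounded (μ := μ) hu h] with x h1 h2
  rw [h1, h2]

theorem pt_real_smul (r : ℝ) (v : M) :
    ∀ᵐ x ∂μ, pt p μ (r • v) x = |r| * pt p μ v x := by
  filter_upwards [pt_smul p μ (r • (1 : LInfty μ)) v, LInfty.coeFn_smul_one (μ := μ) r]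
    with x h1 h2
  -- The scalar tower identifies `r • v` with the action of the constant function `r`.
  rw [smul_assoc, one_smul] at h1
  rw [h1, h2]

theorem pt_neg (v : M) : ∀ᵐ x ∂μ, pt p μ (-v) x = pt p μ v x := by
  filter_upwards [pt_real_smul p μ (-1) v] with x h
  rw [neg_one_smul] at h
  rw [h]; simp

theorem pt_sub_le (v w : M) : ∀ᵐ x ∂μ, pt p μ (v - w) x ≤ pt p μ v x + pt p μ w x := by
  filter_upwards [pt_add_le p μ v (-w), pt_neg p μ w] with x h1 h2
  rw [sub_eq_add_neg, ← h2]; exact h1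

variable {p} in
theorem integrable_pt_rpow (hp₁ : 1 < p) (hp : p < ∞) (v : M) :
    Integrable (fun x => pt p μ v x ^ p.toReal) μ := by
  have h := (Lp.memLp (LpNormedModule.ptNorm (p := p) (μ := μ) v)).integrable_norm_rpow
    (by positivity) hp.ne
  refine h.congr ?_
  filter_upwards [pt_nonneg p μ v] with x hx
  exact congrArg (· ^ p.toReal) (Real.norm_of_nonneg hx)

variable {p} in
theorem norm_rpow_eq_integral (hp₁ : 1 < p) (hp : p < ∞) (v : M) :
    ‖v‖ ^ p.toReal = ∫ x, pt p μ v x ^ p.toReal ∂μ := by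
  have hP : 0 < p.toReal := ENNReal.toReal_pos (by positivity) hp.ne
  have e : ∫ x, ‖LpNormedModule.ptNorm (p := p) (μ := μ) v x‖ ^ p.toReal ∂μ =
      ∫ x, pt p μ v x ^ p.toReal ∂μ := by
    refine integral_congr_ae ?_
    filter_upwards [pt_nonneg p μ v] with x hx
    exact congrArg (· ^ p.toReal) (Real.norm_of_nonneg hx)
  have h0 : 0 ≤ ∫ x, pt p μ v x ^ p.toReal ∂μ :=
    integral_nonneg_of_ae (by
      filter_upwards [pt_nonneg p μ v] with x hx
      exact Real.rpow_nonneg hx _)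
  rw [LpNormedModule.norm_eq (p := p) (μ := μ) v, Lp.norm_def,
    (Lp.memLp (LpNormedModule.ptNorm (p := p) (μ := μ) v)).eLpNorm_eq_integral_rpow_norm
      (by positivity) hp.ne, e, ENNReal.toReal_ofReal (by positivity),
    ← Real.rpow_mul h0, inv_mul_cancel₀ hP.ne', Real.rpow_one]

variable {p} in
theorem norm_indicator_smul_rpow (hp₁ : 1 < p) (hp : p < ∞) {F : Set X} (hF : MeasurableSet F)
    {c : ℝ} (hc : 0 ≤ c) (hm : Measurable (F.indicator fun _ => c))
    (hb : ∃ C, ∀ x, |F.indicator (fun _ => c) x| ≤ C) (v : M) :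
    ‖LInfty.ofBounded μ (F.indicator fun _ => c) hm hb • v‖ ^ p.toReal =
      c ^ p.toReal * ∫ x in F, pt p μ v x ^ p.toReal ∂μ := by
  have hP : 0 < p.toReal := ENNReal.toReal_pos (by positivity) hp.ne
  rw [norm_rpow_eq_integral μ hp₁ hp, ← integral_indicator hF, ← integral_const_mul]
  refine integral_congr_ae ?_
  filter_upwards [pt_ofBounded_smul p μ hm hb v, pt_nonneg p μ v] with x h1 h2
  rw [h1]
  by_cases hx : x ∈ F
  · simp only [indicator_of_mem hx]
    rw [abs_of_nonneg hc, Real.mul_rpow hc h2]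
  · simp only [indicator_of_notMem hx]
    rw [abs_zero, zero_mul, Real.zero_rpow hP.ne', mul_zero]

end Pointwise

/-! ### Elementary bounds for the Banach-space modulus -/

theorem bddBelow_modulus (B : Type*) [NormedAddCommGroup B] [NormedSpace ℝ B] (ε : ℝ) :
    BddBelow (insert 1 {r | ∃ v w : B, ‖v‖ = 1 ∧ ‖w‖ = 1 ∧ ε ≤ ‖v - w‖ ∧
      r = 1 - ‖(1 / 2 : ℝ) • (v + w)‖}) := by
  refine ⟨0, ?_⟩
  rintro r (rfl | ⟨v, w, hv, hw, -, rfl⟩)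
  · norm_num
  · rw [norm_smul, Real.norm_of_nonneg (by norm_num)]
    linarith [norm_add_le v w]

theorem modulus_le_one (B : Type*) [NormedAddCommGroup B] [NormedSpace ℝ B] (ε : ℝ) :
    modulus B ε ≤ 1 := csInf_le (bddBelow_modulus B ε) (mem_insert _ _)

theorem modulus_le {B : Type*} [NormedAddCommGroup B] [NormedSpace ℝ B] {ε : ℝ} {v w : B}
    (hv : ‖v‖ = 1) (hw : ‖w‖ = 1) (h : ε ≤ ‖v - w‖) :
    modulus B ε ≤ 1 - ‖(1 / 2 : ℝ) • (v + w)‖ :=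
  csInf_le (bddBelow_modulus B ε) (mem_insert_of_mem _ ⟨v, w, hv, hw, h, rfl⟩)

/-! ### The Banach-space modulus is at most the pointwise modulus -/

section Comparison

variable {X : Type*} [MeasurableSpace X] {p : ℝ≥0∞} (μ : Measure X)
  {M : Type*} [NormedAddCommGroup M] [NormedSpace ℝ M]
  [Module (LInfty μ) M] [IsScalarTower ℝ (LInfty μ) M] [LpNormedModule p μ M]

/-- If `|v| = |w| = 1` and `|v - w| > ε` on a set of finite positive measure, then `|(v + w) / 2|`
cannot exceed `1 - δ` throughout that set, for any `δ < δ_M(ε)`. -/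
theorem measure_eq_zero_of_lt_modulus (hp₁ : 1 < p) (hp : p < ∞) {ε δ : ℝ} (hε : 0 < ε)
    (hδ : δ < modulus M ε) (v w : M) {F : Set X} (hF : MeasurableSet F) (hFfin : μ F < ∞)
    (h : ∀ᵐ x ∂μ, x ∈ F → pt p μ v x = 1 ∧ pt p μ w x = 1 ∧ ε ≤ pt p μ (v - w) x ∧
      1 - δ ≤ pt p μ ((1 / 2 : ℝ) • (v + w)) x) : μ F = 0 := by
  by_contra hne
  set P := p.toReal with hPdef
  have hP : 0 < P := ENNReal.toReal_pos (by positivity) hp.ne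
  have hδ1 : 0 ≤ 1 - δ := by linarith [modulus_le_one M ε]
  set m := μ.real F with hm
  have hm0 : 0 < m := ENNReal.toReal_pos hne hFfin.ne
  -- With this height, `c` times the indicator of `F` has unit `L^P` norm.
  set c := m ^ (-P⁻¹) with hcdef
  have hc : 0 < c := Real.rpow_pos_of_pos hm0 _
  have hcm : c ^ P * m = 1 := by
    rw [hcdef, ← Real.rpow_mul hm0.le, neg_mul, inv_mul_cancel₀ hP.ne', Real.rpow_neg_one,
      inv_mul_cancel₀ hm0.ne']
  have hmeas : Measurable (F.indicator fun _ => c) := measurable_const.indicator hF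
  have hbd : ∃ C, ∀ x, |F.indicator (fun _ => c) x| ≤ C := by
    refine ⟨c, fun x => ?_⟩
    by_cases hx : x ∈ F
    · rw [indicator_of_mem hx, abs_of_pos hc]
    · rw [indicator_of_notMem hx, abs_zero]; exact hc.le
  set f := LInfty.ofBounded μ _ hmeas hbd with hf
  have hconst : ∀ r : ℝ, ∫ _ in F, r ^ P ∂μ = m * r ^ P := fun r => by
    rw [setIntegral_const, smul_eq_mul]
  have hlow : ∀ (u : M) (r : ℝ), 0 ≤ r → (∀ᵐ x ∂μ, x ∈ F → r ≤ pt p μ u x) → r ≤ ‖f • u‖ := by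
    intro u r hr hu
    rw [← Real.rpow_le_rpow_iff hr (norm_nonneg _) hP,
      norm_indicator_smul_rpow μ hp₁ hp hF hc.le]
    calc r ^ P = c ^ P * (m * r ^ P) := by rw [← mul_assoc, hcm, one_mul]
      _ ≤ _ := by
        rw [← hconst]
        refine mul_le_mul_of_nonneg_left ?_ (Real.rpow_nonneg hc.le _)
        refine setIntegral_mono_on_ae (integrableOn_const hFfin.ne)
          (integrable_pt_rpow μ hp₁ hp u).integrableOn hF ?_
        filter_upwards [hu] with x hx hxF
        exact Real.rpow_le_rpow hr (hx hxF) hP.le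
  have hunit : ∀ u : M, (∀ᵐ x ∂μ, x ∈ F → pt p μ u x = 1) → ‖f • u‖ = 1 := by
    intro u hu
    have : ‖f • u‖ ^ P = 1 := by
      rw [norm_indicator_smul_rpow μ hp₁ hp hF hc.le,
        setIntegral_congr_ae (g := fun _ => (1 : ℝ) ^ P) hF (by
          filter_upwards [hu] with x hx hxF
          rw [hx hxF]), hconst, Real.one_rpow, mul_one, hcm]
    exact (Real.rpow_left_inj (norm_nonneg _) zero_le_one hP.ne').1 (by rw [this, Real.one_rpow])
  have hv := hunit v (h.mono fun x hx hxF => (hx hxF).1)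
  have hw := hunit w (h.mono fun x hx hxF => (hx hxF).2.1)
  have hd := hlow (v - w) ε hε.le (h.mono fun x hx hxF => (hx hxF).2.2.1)
  have hs := hlow ((1 / 2 : ℝ) • (v + w)) (1 - δ) hδ1 (h.mono fun x hx hxF => (hx hxF).2.2.2)
  rw [smul_sub] at hd
  have hcomm : f • ((1 / 2 : ℝ) • (v + w)) = (1 / 2 : ℝ) • (f • v + f • w) := by
    rw [← smul_add, ← smul_one_smul (LInfty μ) (1 / 2 : ℝ) (v + w),
      ← smul_one_smul (LInfty μ) (1 / 2 : ℝ) (f • (v + w)), smul_smul, smul_smul, mul_comm]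
  rw [hcomm] at hs
  linarith [modulus_le hv hw hd]

/-- Every constant `δ < modulus M ε` is a lower bound of the family defining the pointwise modulus:
a violation on a set of positive measure would, by `σ`-finiteness, contain one on a set of finite
positive measure. -/
theorem modulus_le_essInfPtModulus [SigmaFinite μ] (hp₁ : 1 < p) (hp : p < ∞) {ε : ℝ}
    (hε : 0 < ε) : (modulus M ε : EReal) ≤ essInfPtModulus μ p M ε := by
  rw [← EReal.ge_of_forall_gt_iff_ge]
  intro δ hδ
  have hδ' : δ < modulus M ε := EReal.coe_lt_coe_iff.1 hδ
  have hδ1 : δ < 1 := hδ'.trans_le (modulus_le_one M ε)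
  have key : AEEqFun.const X (δ : EReal) ≤ ptModulus μ p M ε := by
    refine (isGLB_familyInf _).2 ?_
    rintro g ⟨v, w, E, hE, hvw, hg⟩
    rw [← AEEqFun.coeFn_le]
    set S : Set X := {x | 1 - δ ≤ pt p μ ((1 / 2 : ℝ) • (v + w)) x} with hS
    have hSm : MeasurableSet S := measurableSet_le measurable_const (measurable_pt p μ _)
    have hnull : μ (E ∩ S) = 0 := by
      by_contra hne
      obtain ⟨F, hF, hFsub, hF0, hFfin⟩ := Measure.exists_subset_measure_lt_top (hE.inter hSm)
        (pos_iff_ne_zero.2 hne)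
      refine hF0.ne' (measure_eq_zero_of_lt_modulus μ hp₁ hp hε hδ' v w hF hFfin ?_)
      filter_upwards [hvw] with x hx hxF
      obtain ⟨h1, h2, h3⟩ := hx (hFsub hxF).1
      exact ⟨h1, h2, h3.le, (hFsub hxF).2⟩
    have hae : ∀ᵐ x ∂μ, x ∉ E ∩ S := measure_eq_zero_iff_ae_notMem.1 hnull
    filter_upwards [hg, hae, AEEqFun.coeFn_const X (μ := μ) (δ : EReal)] with x h1 h2 h3
    rw [h1, h3, Function.const_apply, EReal.coe_le_coe_iff]
    by_cases hx : x ∈ E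
    · rw [indicator_of_mem hx]
      have : ¬ (1 - δ ≤ pt p μ ((1 / 2 : ℝ) • (v + w)) x) := fun h => h2 ⟨hx, h⟩
      unfold pt at this
      linarith
    · rw [indicator_of_notMem hx]; linarith
  rw [← AEEqFun.coeFn_le] at key
  refine le_essInf_of_ae_le _ ?_
  filter_upwards [key, AEEqFun.coeFn_const X (μ := μ) (δ : EReal)] with x h1 h2
  rw [h2] at h1
  exact h1

theorem essInfPtModulus_le_one [SigmaFinite μ] (hμ : μ ≠ 0) (ε : ℝ) :
    essInfPtModulus μ p M ε ≤ 1 := by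
  have : (ae μ).NeBot := ae_neBot.2 hμ
  have h1 : ptModulus μ p M ε ≤ AEEqFun.const X (1 : EReal) := by
    refine (isGLB_familyInf _).1 ⟨0, 0, ∅, MeasurableSet.empty, by simp, ?_⟩
    filter_upwards [AEEqFun.coeFn_const X (μ := μ) (1 : EReal)] with x hx
    rw [hx]; simp
  rw [← AEEqFun.coeFn_le] at h1
  obtain ⟨x, h2, h3, h4⟩ := (h1.and ((AEEqFun.coeFn_const X (μ := μ) (1 : EReal)).and
    (ae_essInf_le (f := fun x => ptModulus μ p M ε x) (μ := μ)))).exists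
  rw [h3] at h2
  exact h4.trans h2

/-! ### The pointwise modulus controls the Banach-space modulus -/

/-- The defining property of the pointwise modulus of convexity. -/
theorem pt_add_le_of_le_essInf [SigmaFinite μ] {η t : ℝ}
    (ht : (t : EReal) ≤ essInfPtModulus μ p M η) (v w : M) {F : Set X} (hF : MeasurableSet F)
    (hv : ∀ᵐ x ∂μ, x ∈ F → pt p μ v x = 1) (hw : ∀ᵐ x ∂μ, x ∈ F → pt p μ w x = 1) :
    ∀ᵐ x ∂μ, x ∈ F → η < pt p μ (v - w) x → pt p μ (v + w) x ≤ 2 * (1 - t) := by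
  set E : Set X := F ∩ {x | η < pt p μ (v - w) x} with hEdef
  have hE : MeasurableSet E :=
    hF.inter (measurableSet_lt measurable_const (measurable_pt p μ _))
  set u : X → EReal := fun x =>
    ((1 - E.indicator (pt p μ ((1 / 2 : ℝ) • (v + w))) x : ℝ) : EReal) with hu
  have hum : Measurable u := measurable_coe_real_ereal.comp
    (measurable_const.sub ((measurable_pt p μ _).indicator hE))
  have h1 : ptModulus μ p M η ≤ AEEqFun.mk u hum.aestronglyMeasurable := by
    refine (isGLB_familyInf _).1 ⟨v, w, E, hE, ?_, AEEqFun.coeFn_mk u hum.aestronglyMeasurable⟩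
    filter_upwards [hv, hw] with x h1 h2 hx
    exact ⟨h1 hx.1, h2 hx.1, hx.2⟩
  rw [← AEEqFun.coeFn_le] at h1
  filter_upwards [h1, AEEqFun.coeFn_mk u hum.aestronglyMeasurable (μ := μ),
    ae_essInf_le (f := fun x => ptModulus μ p M η x) (μ := μ),
    pt_real_smul p μ (1 / 2) (v + w)] with x h2 h3 h4 h5 hx hlt
  rw [h3] at h2
  have h6 : (t : EReal) ≤ u x := ht.trans (h4.trans h2)
  rw [hu, EReal.coe_le_coe_iff, indicator_of_mem (show x ∈ E from ⟨hx, hlt⟩), h5,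
    abs_of_pos (by norm_num)] at h6
  linarith

/-- The pointwise convexity estimate on a set where `|v|` and `|w|` are bounded and bounded away
from zero. -/
theorem pt_add_le_on [SigmaFinite μ] {η t : ℝ} (ht : (t : EReal) ≤ essInfPtModulus μ p M η)
    (v w : M) {r R : ℝ} (hr : 0 < r) :
    ∀ᵐ x ∂μ, pt p μ v x ∈ Icc r R → pt p μ w x ∈ Icc r R →
      |pt p μ v x - pt p μ w x| + η * min (pt p μ v x) (pt p μ w x) < pt p μ (v - w) x →
      pt p μ (v + w) x ≤
        pt p μ v x + pt p μ w x - 2 * t * min (pt p μ v x) (pt p μ w x) := by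
  have hmv := measurable_pt p μ v
  have hmw := measurable_pt p μ w
  set a := pt p μ v with ha
  set b := pt p μ w with hb
  set F : Set X := {x | a x ∈ Icc r R ∧ b x ∈ Icc r R} with hFdef
  have hF : MeasurableSet F := (hmv measurableSet_Icc).inter (hmw measurableSet_Icc)
  have bdd : ∀ (u : X → ℝ) (C : ℝ), (∀ x ∈ F, |u x| ≤ C) → ∃ C, ∀ x, |F.indicator u x| ≤ C := by
    intro u C hC
    refine ⟨|C|, fun x => ?_⟩
    by_cases hx : x ∈ F
    · rw [indicator_of_mem hx]; exact (hC x hx).trans (le_abs_self C)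
    · rw [indicator_of_notMem hx, abs_zero]; exact abs_nonneg C
  have abs_inv_le : ∀ y ∈ Icc r R, |y⁻¹| ≤ r⁻¹ := fun y hy => by
    rw [abs_of_pos (inv_pos.2 (hr.trans_le hy.1))]; exact inv_anti₀ hr hy.1
  let ind (u : X → ℝ) (hu : Measurable u) (h : ∃ C, ∀ x ∈ F, |u x| ≤ C) : LInfty μ :=
    LInfty.ofBounded μ (F.indicator u) (hu.indicator hF) (by
      obtain ⟨C, hC⟩ := h; exact bdd u C hC)
  have ind_coe : ∀ u hu h, ∀ᵐ x ∂μ, (ind u hu h : X →ₘ[μ] ℝ) x = F.indicator u x :=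
    fun u hu h => LInfty.coeFn_ofBounded _ _
  have ind_pt : ∀ u hu h (z : M), ∀ᵐ x ∂μ, x ∈ F →
      pt p μ (ind u hu h • z) x = |u x| * pt p μ z x := by
    intro u hu h z
    filter_upwards [pt_smul p μ (ind u hu h) z, ind_coe u hu h] with x h1 h2 hx
    rw [h1, h2, indicator_of_mem hx]
  have mmn : Measurable fun x => min (a x) (b x) := hmv.min hmw
  have mia : Measurable fun x => (a x)⁻¹ := hmv.inv
  have mib : Measurable fun x => (b x)⁻¹ := hmw.inv
  have mra : Measurable fun x => a x - min (a x) (b x) := hmv.sub mmn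
  have mrb : Measurable fun x => b x - min (a x) (b x) := hmw.sub mmn
  have mn_pos : ∀ x ∈ F, 0 < min (a x) (b x) := fun x hx =>
    lt_min (hr.trans_le hx.1.1) (hr.trans_le hx.2.1)
  have bone : ∃ C, ∀ x ∈ F, |(fun _ => 1 : X → ℝ) x| ≤ C := ⟨1, fun _ _ => by simp⟩
  have bmn : ∃ C, ∀ x ∈ F, |min (a x) (b x)| ≤ C := ⟨R, fun x hx => by
    rw [abs_of_pos (mn_pos x hx)]
    exact (min_le_left _ _).trans hx.1.2⟩
  have bra : ∃ C, ∀ x ∈ F, |a x - min (a x) (b x)| ≤ C := ⟨R, fun x hx => by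
    rw [abs_of_nonneg (sub_nonneg.2 (min_le_left _ _))]
    linarith [hx.1.2, mn_pos x hx]⟩
  have brb : ∃ C, ∀ x ∈ F, |b x - min (a x) (b x)| ≤ C := ⟨R, fun x hx => by
    rw [abs_of_nonneg (sub_nonneg.2 (min_le_right _ _))]
    linarith [hx.2.2, mn_pos x hx]⟩
  have bia : ∃ C, ∀ x ∈ F, |(a x)⁻¹| ≤ C := ⟨r⁻¹, fun x hx => abs_inv_le _ hx.1⟩
  have bib : ∃ C, ∀ x ∈ F, |(b x)⁻¹| ≤ C := ⟨r⁻¹, fun x hx => abs_inv_le _ hx.2⟩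
  let one := ind (fun _ => 1) measurable_const bone
  let ia := ind (fun x => (a x)⁻¹) mia bia
  let ib := ind (fun x => (b x)⁻¹) mib bib
  let mn := ind (fun x => min (a x) (b x)) mmn bmn
  let ra := ind (fun x => a x - min (a x) (b x)) mra bra
  let rb := ind (fun x => b x - min (a x) (b x)) mrb brb
  -- On `F`, this splits `v` as `m v' + (a - m) v'` with `v' = v / a` and `m = min a b`; `w` is
  -- split likewise. The restriction to `F` keeps the inverses in `L^∞(μ)`.
  have hone_a : one = (mn + ra) * ia := by
    apply LInfty.ext_ae
    filter_upwards [ind_coe _ measurable_const bone, ind_coe _ mmn bmn,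
      ind_coe _ mra bra, ind_coe _ mia bia, LInfty.coeFn_mul (mn + ra) ia, LInfty.coeFn_add mn ra] with x h1 h2 h3 h4 h5 h6
    rw [h5, h6, h1, h2, h3, h4]
    by_cases hx : x ∈ F
    · simp only [indicator_of_mem hx]
      rw [add_sub_cancel, mul_inv_cancel₀ (hr.trans_le hx.1.1).ne']
    · simp only [indicator_of_notMem hx]; ring
  have hone_b : one = (mn + rb) * ib := by
    apply LInfty.ext_ae
    filter_upwards [ind_coe _ measurable_const bone, ind_coe _ mmn bmn,
      ind_coe _ mrb brb, ind_coe _ mib bib, LInfty.coeFn_mul (mn + rb) ib, LInfty.coeFn_add mn rb] with x h1 h2 h3 h4 h5 h6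
    rw [h5, h6, h1, h2, h3, h4]
    by_cases hx : x ∈ F
    · simp only [indicator_of_mem hx]
      rw [add_sub_cancel, mul_inv_cancel₀ (hr.trans_le hx.2.1).ne']
    · simp only [indicator_of_notMem hx]; ring
  have hv1 : ∀ᵐ x ∂μ, x ∈ F → pt p μ (ia • v) x = 1 := by
    filter_upwards [ind_pt _ mia bia v] with x hx hxF
    rw [hx hxF, abs_of_pos (inv_pos.2 (hr.trans_le hxF.1.1)),
      inv_mul_cancel₀ (hr.trans_le hxF.1.1).ne']
  have hw1 : ∀ᵐ x ∂μ, x ∈ F → pt p μ (ib • w) x = 1 := by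
    filter_upwards [ind_pt _ mib bib w] with x hx hxF
    rw [hx hxF, abs_of_pos (inv_pos.2 (hr.trans_le hxF.2.1)),
      inv_mul_cancel₀ (hr.trans_le hxF.2.1).ne']
  have hov : one • v = mn • ia • v + ra • ia • v := by
    rw [hone_a, mul_smul, add_smul]
  have how : one • w = mn • ib • w + rb • ib • w := by
    rw [hone_b, mul_smul, add_smul]
  have hadd : one • (v + w) = mn • (ia • v + ib • w) + (ra • ia • v + rb • ib • w) := by
    rw [smul_add, hov, how, smul_add]; abel
  have hsub : one • (v - w) = mn • (ia • v - ib • w) + (ra • ia • v - rb • ib • w) := by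
    rw [smul_sub, hov, how, smul_sub]; abel
  have hpt_one : ∀ z : M, ∀ᵐ x ∂μ, x ∈ F → pt p μ (one • z) x = |1| * pt p μ z x :=
    ind_pt _ measurable_const bone
  have hpt_mn : ∀ z : M, ∀ᵐ x ∂μ, x ∈ F →
      pt p μ (mn • z) x = |min (a x) (b x)| * pt p μ z x := ind_pt _ mmn bmn
  have hpt_ra : ∀ᵐ x ∂μ, x ∈ F →
      pt p μ (ra • ia • v) x = |a x - min (a x) (b x)| * pt p μ (ia • v) x :=
    ind_pt _ mra bra _
  have hpt_rb : ∀ᵐ x ∂μ, x ∈ F →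
      pt p μ (rb • ib • w) x = |b x - min (a x) (b x)| * pt p μ (ib • w) x :=
    ind_pt _ mrb brb _
  filter_upwards [pt_add_le_of_le_essInf μ ht (ia • v) (ib • w) hF hv1 hw1, hv1, hw1,
    hpt_one (v + w), hpt_one (v - w), hpt_mn (ia • v + ib • w), hpt_mn (ia • v - ib • w),
    hpt_ra, hpt_rb,
    pt_add_le p μ (mn • (ia • v + ib • w)) (ra • ia • v + rb • ib • w),
    pt_add_le p μ (mn • (ia • v - ib • w)) (ra • ia • v - rb • ib • w),
    pt_add_le p μ (ra • ia • v) (rb • ib • w), pt_sub_le p μ (ra • ia • v) (rb • ib • w)]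
    with x h1 h2 h3 h4 h5 h6 h7 h8 h9 h10 h11 h12 h13 hav hbw hlt
  have hx : x ∈ F := ⟨hav, hbw⟩
  have e4 := h4 hx
  have e5 := h5 hx
  have e6 := h6 hx
  have e7 := h7 hx
  have e8 := h8 hx
  have e9 := h9 hx
  have hm0 := mn_pos x hx
  have hma := min_le_left (a x) (b x)
  have hmb := min_le_right (a x) (b x)
  -- The remainders have total pointwise norm `|a - b|`. Hence the assumed lower bound on `|v - w|`
  -- forces the normalised vectors to be more than `η` apart, and the estimate for their sum is
  -- scaled by `m`.
  have habs : |a x - b x| = (a x - min (a x) (b x)) + (b x - min (a x) (b x)) := by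
    rcases le_total (a x) (b x) with h | h
    · rw [min_eq_left h, abs_of_nonpos (by linarith)]; ring
    · rw [min_eq_right h, abs_of_nonneg (by linarith)]; ring
  rw [abs_one, one_mul] at e4 e5
  rw [abs_of_pos hm0] at e6 e7
  rw [h2 hx, mul_one, abs_of_nonneg (by linarith)] at e8
  rw [h3 hx, mul_one, abs_of_nonneg (by linarith)] at e9
  rw [← hadd, e4, e6] at h10
  rw [← hsub, e5, e7] at h11
  rw [e8, e9] at h12 h13
  have hη : η < pt p μ (ia • v - ib • w) x := by
    refine lt_of_mul_lt_mul_left ?_ hm0.le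
    rw [mul_comm]; linarith
  have := mul_le_mul_of_nonneg_left (h1 hx hη) hm0.le
  linarith

/-- Where both norms are positive, they lie in `[1 / (n + 1), n]` for some `n`, so countably many
truncated estimates suffice. Where one vanishes, the `t` term is zero and the triangle inequality is
enough. -/
theorem pt_add_le_of_pt_sub_gt [SigmaFinite μ] {η t : ℝ}
    (ht : (t : EReal) ≤ essInfPtModulus μ p M η) (v w : M) :
    ∀ᵐ x ∂μ,
      |pt p μ v x - pt p μ w x| + η * min (pt p μ v x) (pt p μ w x) < pt p μ (v - w) x →
      pt p μ (v + w) x ≤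
        pt p μ v x + pt p μ w x - 2 * t * min (pt p μ v x) (pt p μ w x) := by
  have key : ∀ᵐ x ∂μ, ∀ n : ℕ, _ :=
    ae_all_iff.2 fun n : ℕ => pt_add_le_on μ ht v w (r := 1 / ((n : ℝ) + 1)) (R := n)
      Nat.one_div_pos_of_nat
  filter_upwards [key, pt_nonneg p μ v, pt_nonneg p μ w, pt_add_le p μ v w]
    with x h ha hb hadd hlt
  rcases (le_min ha hb).eq_or_lt with h0 | h0
  · rw [← h0]; linarith
  · obtain ⟨k, hk⟩ := exists_nat_one_div_lt h0
    obtain ⟨l, hl⟩ := exists_nat_ge (max (pt p μ v x) (pt p μ w x))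
    have h1 : 1 / (((max k l : ℕ) : ℝ) + 1) ≤ min (pt p μ v x) (pt p μ w x) :=
      (Nat.one_div_le_one_div (le_max_left k l)).trans hk.le
    have h2 : max (pt p μ v x) (pt p μ w x) ≤ ((max k l : ℕ) : ℝ) :=
      hl.trans (by exact_mod_cast le_max_right k l)
    exact h (max k l) ⟨h1.trans (min_le_left _ _), (le_max_left _ _).trans h2⟩
      ⟨h1.trans (min_le_right _ _), (le_max_right _ _).trans h2⟩ hlt

/-- Integrating `rpow_dist_le` for unit vectors gives `ε ^ P ≤ 2 * (ε / 4) ^ P + 2 ^ P / c * (1 -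
‖u‖ ^ P)`, with `u` the midpoint; it remains to pass from `‖u‖ ^ P` to `‖u‖`. -/
theorem convexityBound_le_modulus [SigmaFinite μ] (hp₁ : 1 < p) (hp : p < ∞) {ε t : ℝ}
    (hε : ε ∈ Ioc (0 : ℝ) 2) (ht01 : t ∈ Ioc (0 : ℝ) 1)
    (ht : (t : EReal) ≤ essInfPtModulus μ p M (ε / 5)) :
    convexityBound p.toReal ε t ≤ modulus M ε := by
  have hP : 1 < p.toReal := by
    rw [← ENNReal.toReal_one]; exact (ENNReal.toReal_lt_toReal (by simp) hp.ne).2 hp₁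
  set P := p.toReal with hPdef
  have hP0 : 0 < P := by linarith
  have hε0 := hε.1
  refine le_csInf (insert_nonempty _ _) ?_
  rintro r (rfl | ⟨v, w, hv, hw, hd, rfl⟩)
  · exact convexityBound_le_one hP hε ht01
  set u := (1 / 2 : ℝ) • (v + w) with hu
  set c := gapConst P ε t with hc
  have hc0 : 0 < c := gapConst_pos hP hε ht01.1
  have hpt : ∀ᵐ x ∂μ, pt p μ (v - w) x ^ P ≤
      (ε / 4) ^ P * (pt p μ v x ^ P + pt p μ w x ^ P) +
        2 ^ P / c * ((pt p μ v x ^ P + pt p μ w x ^ P) / 2 - pt p μ u x ^ P) := by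
    filter_upwards [pt_add_le_of_pt_sub_gt μ ht v w, pt_nonneg p μ v, pt_nonneg p μ w,
      pt_nonneg p μ (v - w), pt_nonneg p μ (v + w), pt_add_le p μ v w, pt_sub_le p μ v w,
      pt_real_smul p μ (1 / 2) (v + w)] with x h1 h2 h3 h4 h5 h6 h7 h8
    rw [h8, abs_of_pos (by norm_num), one_div_mul_eq_div]
    exact rpow_dist_le hP hε ht01 h2 h3 h4 h7 h5 h6 h1
  have iv := integrable_pt_rpow (p := p) μ hp₁ hp v
  have iw := integrable_pt_rpow (p := p) μ hp₁ hp w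
  have iu := integrable_pt_rpow (p := p) μ hp₁ hp u
  have ivw : Integrable (fun x => pt p μ v x ^ P + pt p μ w x ^ P) μ := iv.add iw
  have igap : Integrable (fun x => (pt p μ v x ^ P + pt p μ w x ^ P) / 2 - pt p μ u x ^ P) μ :=
    (ivw.div_const 2).sub iu
  have hint := integral_mono_ae (integrable_pt_rpow μ hp₁ hp (v - w))
    ((ivw.const_mul ((ε / 4) ^ P)).add (igap.const_mul (2 ^ P / c))) hpt
  have e : ∫ x, ((ε / 4) ^ P * (pt p μ v x ^ P + pt p μ w x ^ P) +
        2 ^ P / c * ((pt p μ v x ^ P + pt p μ w x ^ P) / 2 - pt p μ u x ^ P)) ∂μ =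
      (ε / 4) ^ P * (‖v‖ ^ P + ‖w‖ ^ P) +
        2 ^ P / c * ((‖v‖ ^ P + ‖w‖ ^ P) / 2 - ‖u‖ ^ P) := by
    rw [integral_add (ivw.const_mul _) (igap.const_mul _), integral_const_mul,
      integral_const_mul, integral_sub (ivw.div_const 2) iu, integral_div, integral_add iv iw,
      norm_rpow_eq_integral μ hp₁ hp v, norm_rpow_eq_integral μ hp₁ hp w,
      norm_rpow_eq_integral μ hp₁ hp u]
  have hint' : ‖v - w‖ ^ P ≤ (ε / 4) ^ P * (‖v‖ ^ P + ‖w‖ ^ P) +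
      2 ^ P / c * ((‖v‖ ^ P + ‖w‖ ^ P) / 2 - ‖u‖ ^ P) := by
    rw [norm_rpow_eq_integral μ hp₁ hp (v - w), ← e]; exact hint
  rw [hv, hw, Real.one_rpow] at hint'
  have hdP : ε ^ P ≤ ‖v - w‖ ^ P := Real.rpow_le_rpow hε0.le hd hP0.le
  -- Thus `2 * (ε / 4) ^ P` absorbs at most half of `ε ^ P`.
  have h4 : (ε / 4) ^ P ≤ ε ^ P / 4 := by
    rw [Real.div_rpow hε0.le (by norm_num)]
    refine div_le_div_of_nonneg_left (by positivity) (by norm_num) ?_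
    calc (4 : ℝ) = 4 ^ (1 : ℝ) := (Real.rpow_one 4).symm
      _ ≤ 4 ^ P := Real.rpow_le_rpow_of_exponent_le (by norm_num) hP.le
  have h5 : ε ^ P / 2 ≤ 2 ^ P / c * (1 - ‖u‖ ^ P) := by
    rw [show ((1 + 1) / 2 : ℝ) = 1 by norm_num] at hint'
    linarith
  have h6 : ε ^ P * c / (2 * 2 ^ P) ≤ 1 - ‖u‖ ^ P := by
    rw [div_mul_eq_mul_div, le_div_iff₀ hc0] at h5
    rw [div_le_iff₀ (by positivity)]
    linarith
  -- Bernoulli's inequality gives `1 - ‖u‖ ^ P ≤ P * (1 - ‖u‖)`, the source of the factor `P` in the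
  -- denominator of `convexityBound`.
  have h7 : 1 + P * (‖u‖ - 1) ≤ ‖u‖ ^ P := by
    have := one_add_mul_self_le_rpow_one_add (s := ‖u‖ - 1) (by linarith [norm_nonneg u]) hP.le
    rwa [add_sub_cancel] at this
  have h8 : convexityBound P ε t = ε ^ P * c / (2 * 2 ^ P) / P := by
    rw [convexityBound, div_div]
  rw [h8, div_le_iff₀ hP0]
  linarith

/-- The competitor with `E = ∅` bounds the essential infimum by `1` when `μ ≠ 0`, so `toReal` loses
nothing. -/
theorem coe_toReal_essInfPtModulus [SigmaFinite μ] (hμ : μ ≠ 0) {η : ℝ}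
    (h : 0 < essInfPtModulus μ p M η) :
    ((essInfPtModulus μ p M η).toReal : EReal) = essInfPtModulus μ p M η ∧
      (essInfPtModulus μ p M η).toReal ∈ Ioc (0 : ℝ) 1 := by
  have h1 : essInfPtModulus μ p M η ≤ 1 := essInfPtModulus_le_one μ hμ η
  have e : ((essInfPtModulus μ p M η).toReal : EReal) = essInfPtModulus μ p M η :=
    EReal.coe_toReal (h1.trans_lt (EReal.coe_lt_top 1)).ne (EReal.bot_lt_zero.trans h).ne'
  refine ⟨e, ?_, ?_⟩
  · rw [← e] at h; exact EReal.coe_pos.1 h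
  · rw [← e] at h1; exact_mod_cast h1

end Comparison

theorem eq_zero_of_measure_eq_zero {X : Type*} [MeasurableSpace X] {p : ℝ≥0∞} {μ : Measure X}
    {M : Type*} [NormedAddCommGroup M] [NormedSpace ℝ M] [Module (LInfty μ) M]
    [IsScalarTower ℝ (LInfty μ) M] [LpNormedModule p μ M] (hμ : μ = 0) (v : M) : v = 0 := by
  subst hμ
  rw [← LpNormedModule.ptNorm_eq_zero_iff (p := p) (μ := (0 : Measure X))]
  exact Lp.ext (by simp [Filter.EventuallyEq, ae_zero])

end BanachModule

end

theorem theorem3p3 (p : ℝ≥0∞) (hp₁ : 1 < p) (hp : p < ∞) :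
    ∃ φ : ℝ → ℝ → ℝ,
      (∀ ε ∈ Ioc (0 : ℝ) 2, ∀ t ∈ Ioc (0 : ℝ) 1, φ ε t ∈ Ioc (0 : ℝ) 1) ∧
      ContinuousOn (fun z : ℝ × ℝ => φ z.1 z.2) (Ioc (0 : ℝ) 2 ×ˢ Ioc (0 : ℝ) 1) ∧
      (∀ t ∈ Ioc (0 : ℝ) 1, MonotoneOn (fun ε => φ ε t) (Ioc (0 : ℝ) 2)) ∧
      (∀ ε ∈ Ioc (0 : ℝ) 2, MonotoneOn (fun t => φ ε t) (Ioc (0 : ℝ) 1)) ∧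
      ∀ (X : Type u) [MeasurableSpace X] (μ : Measure X) [SigmaFinite μ]
        (M : Type v) [NormedAddCommGroup M] [NormedSpace ℝ M] [CompleteSpace M]
        [Module (LInfty μ) M] [IsScalarTower ℝ (LInfty μ) M] [LpNormedModule p μ M],
        (IsPtUniformlyConvex μ p M ↔ IsUniformlyConvex M) ∧
        (IsPtUniformlyConvex μ p M → ∀ ε ∈ Ioc (0 : ℝ) 2,
          (μ ≠ 0 → φ ε (essInfPtModulus μ p M (ε / 5)).toReal ≤ modulus M ε) ∧
          (modulus M ε : EReal) ≤ essInfPtModulus μ p M ε) := by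
  have hP : 1 < p.toReal := by
    rw [← ENNReal.toReal_one]; exact (ENNReal.toReal_lt_toReal (by simp) hp.ne).2 hp₁
  refine ⟨convexityBound p.toReal,
    fun ε hε t ht => ⟨convexityBound_pos hP hε ht.1, convexityBound_le_one hP hε ht⟩,
    continuousOn_convexityBound hP _, fun t ht => convexityBound_mono_left hP ht,
    fun ε hε => convexityBound_mono_right hP hε, ?_⟩
  intro X _ μ _ M _ _ _ _ _ _
  have hη : ∀ ε ∈ Ioc (0 : ℝ) 2, ε / 5 ∈ Ioc (0 : ℝ) 2 := fun ε hε =>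
    ⟨by linarith [hε.1], by linarith [hε.1, hε.2]⟩
  refine ⟨⟨fun h ε hε => ?_, fun h ε hε => ?_⟩, fun h ε hε => ⟨fun hμ => ?_, ?_⟩⟩
  -- For `μ = 0` the module is trivial: there are no unit vectors, and only the inserted value `1`
  -- remains in the infimum.
  · by_cases hμ : μ = 0
    · have h1 : (1 : ℝ) ≤ modulus M ε := by
        refine le_csInf (insert_nonempty _ _) ?_
        rintro r (rfl | ⟨v, w, hv, -, -, -⟩)
        · exact le_rfl
        · rw [eq_zero_of_measure_eq_zero (p := p) hμ v, norm_zero] at hv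
          exact absurd hv zero_ne_one
      linarith
    · obtain ⟨e, ht⟩ := coe_toReal_essInfPtModulus μ hμ (h (ε / 5) (hη ε hε))
      exact (convexityBound_pos hP hε ht.1).trans_le
        (convexityBound_le_modulus μ hp₁ hp hε ht e.le)
  · exact (EReal.coe_pos.2 (h ε hε)).trans_le (modulus_le_essInfPtModulus μ hp₁ hp hε.1)
  · obtain ⟨e, ht⟩ := coe_toReal_essInfPtModulus μ hμ (h (ε / 5) (hη ε hε))
    exact convexityBound_le_modulus μ hp₁ hp hε ht e.le
  · exact modulus_le_essInfPtModulus μ hp₁ hp hε.1
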